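/- Let $q$ be a prime power, let $h\in\mathbb F_{q^8}$ satisfy $h^{q^4+1}=-1$, and let $s$ be an integer with $\gcd(s,8)=1$. For a map $f:\mathbb F_{q^8}\to\mathbb F_{q^8}$ put $L_f=\{\langle (x,f(x))\rangle_{\mathbb F_{q^8}} : x\in\mathbb F_{q^8}^*\}\subseteq \mathrm{PG}(1,q^8)$; exponents $i$ in $x^{q^i}$ are read modulo $8$. Two subsets of $\mathrm{PG}(1,q^8)$ are called $\mathrm{P\Gamma L}$-equivalent if a collineation induced by a bijective semilinear map of $\mathbb F_{q^8}^2$ maps one onto the other. Let $$L_{h,4,s}=L_{\psi},\qquad \psi(x)=x^{q^s}+x^{q^{3s}}+h^{1+q^s}x^{q^{5s}}+h^{1-q^{7s}}x^{q^{7s}} .$$ Then $L_{h,4,s}$ is not $\mathrm{P\Gamma L}$-equivalent to any of the following linear sets: 1. $L_{2,r}=L_f$ with $f(x)=x^{q^r}$, where $\gcd(r,8)=1$; 2. $L_{2,r,\eta}=L_f$ with $f(x)=\eta x^{q^r}+x^{q^{7r}}$, where $\gcd(r,8)=1$, $\eta\in\mathbb F_{q^8}$ and $\mathrm N_{q^8/q}(\eta)=\eta^{(q^8-1)/(q-1)}\notin\{0,1\}$;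 3. $L_{8,r,\delta}=L_f$ with $f(x)=\delta x^{q^r}+x^{q^{r+4}}$, where $\gcd(r,4)=1$, $\delta\in\mathbb F_{q^8}$, $\mathrm N_{q^8/q^4}(\delta)=\delta^{q^4+1}\notin\{0,1\}$ and $f$ is scattered, i.e. for all $y\in\mathbb F_{q^8}^*$ and $\kappa\in\mathbb F_{q^8}$, $f(\kappa y)=\kappa f(y)$ implies $\kappa\in\mathbb F_q$. Here the integer $r$ is arbitrary subject to the stated condition; it need not be equal to $s$. -/

import Mathlib

open scoped LinearAlgebra.Projectivization

namespace LinearSets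

variable {F : Type*} [Field F]

/-- The map `x ↦ x ^ (q ^ i)` of `𝔽_{q^n}`, where the integer `i` is read modulo `n`
(as in the algebra of `q`-polynomials modulo `x ^ (q ^ n) - x`). -/
def frob (q n : ℕ) (i : ℤ) (x : F) : F := x ^ q ^ (i % (n : ℤ)).toNat

/-- The linear set `L_f = {⟨(x, f x)⟩ : x ≠ 0}` of the projective line over `F`. -/
def linearSet (f : F → F) : Set (ℙ F (F × F)) :=
  {P | ∃ (x : F) (hx : x ≠ 0),
    P = Projectivization.mk F (x, f x) (fun h0 => hx (congrArg Prod.fst h0))}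

/-- `f` is scattered over `𝔽_q = {κ : κ ^ q = κ}`: if `f (κ y) = κ f y` for some `y ≠ 0`,
then `κ ∈ 𝔽_q`. -/
def IsScattered (q : ℕ) (f : F → F) : Prop :=
  ∀ y : F, y ≠ 0 → ∀ κ : F, f (κ * y) = κ * f y → κ ^ q = κ

/-- Two point sets of the projective line over `F` are `PΓL`-equivalent if some collineation
induced by a bijective semilinear map of `F × F` maps the first onto the second. -/
def PGammaLEquivalent (L L' : Set (ℙ F (F × F))) : Prop :=
  ∃ (σ : F ≃+* F) (φ : (F × F) →ₛₗ[(σ : F →+* F)] (F × F)) (hφ : Function.Bijective φ),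
    Projectivization.map φ hφ.injective '' L = L'

/-- `ψ_{h,t,s}(x) = x^{q^s} + x^{q^{s(t-1)}} + h^{1+q^s} x^{q^{s(t+1)}}
+ h^{1-q^{s(2t-1)}} x^{q^{s(2t-1)}}` on `𝔽_{q^{2t}}`. -/
def psi (q t : ℕ) (h : F) (s : ℤ) (x : F) : F :=
  frob q (2 * t) s x + frob q (2 * t) (s * ((t : ℤ) - 1)) x
    + (h * frob q (2 * t) s h) * frob q (2 * t) (s * ((t : ℤ) + 1)) x
    + (h / frob q (2 * t) (s * (2 * (t : ℤ) - 1)) h)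
      * frob q (2 * t) (s * (2 * (t : ℤ) - 1)) x

/-- `x^{q^s}` on `𝔽_{q^n}` (Gabidulin, pseudoregulus type). -/
def gabidulinPoly (q n : ℕ) (s : ℤ) (x : F) : F := frob q n s x

/-- `η x^{q^s} + x^{q^{(n-1)s}}` on `𝔽_{q^n}` (twisted Gabidulin, Lunardon-Polverino type). -/
def twistedPoly (q n : ℕ) (s : ℤ) (η : F) (x : F) : F :=
  η * frob q n s x + frob q n (((n : ℤ) - 1) * s) x

/-- `δ x^{q^s} + x^{q^{s+n/2}}` on `𝔽_{q^n}`, with `n = 2t`. -/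
def binomialPoly (q t : ℕ) (s : ℤ) (δ : F) (x : F) : F :=
  δ * frob q (2 * t) s x + frob q (2 * t) (s + t) x

end LinearSets

open scoped LinearAlgebra.Projectivization
open Finset

namespace LinearSets

/-! Linearized polynomials are written in the powers `T i` of `x ↦ x ^ q ^ s`, so that `ψ` is
supported on the indices 1, 3, 5, 7 whatever `s` is. For an additive map `b`, every value of `b x /
x` is attained a number of times equal to `-1` in `F`. Hence the sum over `x ≠ 0` of any function of
`b x / x` depends only on `L_b`. For products of conjugates of `b x / x`, orthogonality of the
characters of `Fˣ` turns this sum into minus the permanent of a principal submatrix of the Dickson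
matrix (`FrobeniusFamily.permSum_eq`).

An equivalence of `L_ψ` with `L_g` yields scalars `α, β, γ, δ` and a linearized `b` with `L_b = L_g`
and `b ∘ (α + β ψ) = γ + δ ψ`, where the field automorphism has been absorbed into `h`. For each of
the three families, permanents of order at most 4 force `b` to be supported on at most two odd
indices. Comparison of the odd coefficients then gives `δ = 0`. The even ones say that an odd
binomial composed with `ψ` is `γ` times the identity, and `comp_psiCoeff_zero_eq_zero` gives `γ =
0`. The second row of the matrix of the collineation vanishes, which is absurd. -/

/-- Eight endomorphisms `T i` indexed by `ZMod 8`, additive in `i`, such that products of fewer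
than eight of them with distinct indices determine the indices. -/
structure FrobeniusFamily (F : Type*) [Field F] where
  T : ZMod 8 → F →+* F
  zero_apply : ∀ x, T 0 x = x
  add_apply : ∀ i j x, T (i + j) x = T i (T j x)
  exists_perm : ∀ (n : ℕ), n < 8 → ∀ e f : Fin n → ZMod 8, Function.Injective e →
    (∀ x : Fˣ, ∏ a, T (f a) (x : F) = ∏ a, T (e a) (x : F)) →
    ∃ π : Equiv.Perm (Fin n), ∀ a, f a = e (π a)

/-! ### Sums over the values of `b x / x` -/

section PowerSums

variable {F : Type*} [Field F] [Fintype F] [DecidableEq F]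

/-- Together with 0, a nonempty fibre is the kernel of `b - c`. By Lagrange the order of this group
kills a nonzero element of `F`, so it is 0 in `F`. -/
theorem cast_card_fiber (b : F →+ F) (c : F) :
    ((#{x : Fˣ | b x / x = c} : ℕ) : F) = if ∃ x, x ≠ 0 ∧ b x = c * x then -1 else 0 := by
  classical
  split_ifs with hx
  · obtain ⟨x, hx0, hx⟩ := hx
    let K : AddSubgroup F := (b - AddMonoidHom.mulLeft c).ker
    have hK : ∀ y, y ∈ K ↔ b y = c * y := fun y => by
      simp [K, AddMonoidHom.mem_ker, sub_eq_zero]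
    have h1 : ((Nat.card K : ℕ) : F) = 0 := by
      have h2 : Nat.card K • (⟨x, (hK x).2 hx⟩ : K) = 0 := card_nsmul_eq_zero'
      have h3 := congrArg (Subtype.val) h2
      simp only [AddSubgroup.coe_nsmul, nsmul_eq_mul, AddSubgroup.coe_zero] at h3
      exact (mul_eq_zero.1 h3).resolve_right hx0
    have h4 : #{x : Fˣ | b x / x = c} + 1 = Nat.card K := by
      have h5 : Nat.card K = #{y : F | b y = c * y} := by
        rw [← Fintype.card_subtype, ← Nat.card_eq_fintype_card]
        exact Nat.card_congr (Equiv.subtypeEquivRight hK)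
      have h6 : ({y : F | b y = c * y} : Finset F)
          = insert 0 (({x : Fˣ | b x / x = c} : Finset Fˣ).image Units.val) := by
        ext y
        simp only [mem_filter, mem_univ, true_and, mem_insert, mem_image]
        constructor
        · intro h
          by_cases hy : y = 0
          · exact Or.inl hy
          · exact Or.inr ⟨Units.mk0 y hy, by simp [h, hy], rfl⟩
        · rintro (rfl | ⟨u, hu, rfl⟩)
          · simp
          · rw [← hu]; field_simp
      rw [h5, h6, card_insert_of_notMem (by simp), card_image_of_injective _ Units.val_injective]
    have h7 := congrArg (Nat.cast : ℕ → F) h4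
    rw [h1] at h7
    push_cast at h7
    linear_combination h7
  · rw [Finset.card_eq_zero.2, Nat.cast_zero]
    rw [Finset.filter_eq_empty_iff]
    intro u _ hu
    exact hx ⟨u, u.ne_zero, by rw [← hu]; field_simp⟩

/-- The right side sees only which values are attained, that is, only the linear set of `b`. -/
theorem sum_units_div (b : F →+ F) (Φ : F → F) :
    ∑ x : Fˣ, Φ (b x / x) = ∑ c : F, (if ∃ x, x ≠ 0 ∧ b x = c * x then -1 else 0) * Φ c := by
  rw [← Finset.sum_fiberwise (univ : Finset Fˣ) (fun x : Fˣ => b x / x)]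
  refine Finset.sum_congr rfl fun c _ => ?_
  rw [← cast_card_fiber, ← nsmul_eq_mul, ← Finset.sum_const]
  refine Finset.sum_congr rfl fun x hx => ?_
  rw [(Finset.mem_filter.1 hx).2]

end PowerSums

/-! ### Linearized polynomials and permanents of Dickson matrices -/

namespace FrobeniusFamily

variable {F : Type*} [Field F] (A : FrobeniusFamily F)

/-- The linearized polynomial map `x ↦ ∑ i, b i * T i x`. -/
def eval (b : ZMod 8 → F) : F →+ F :=
  ∑ i, (AddMonoidHom.mulLeft (b i)).comp (A.T i : F →+ F)

theorem eval_apply (b : ZMod 8 → F) (x : F) : A.eval b x = ∑ i, b i * A.T i x := by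
  simp [eval]

/-- The permanent of a principal submatrix of the Dickson matrix of `b`. -/
def permSum {n : ℕ} (b : ZMod 8 → F) (e : Fin n → ZMod 8) : F :=
  ∑ π : Equiv.Perm (Fin n), ∏ a, A.T (e a) (b (e (π a) - e a))

/-- The multiplicative character `x ↦ ∏ a, T (f a) x / T (e a) x`. -/
def quotChar {n : ℕ} (f e : Fin n → ZMod 8) : Fˣ →* F where
  toFun x := ∏ a, A.T (f a) (x : F) / A.T (e a) (x : F)
  map_one' := by simp
  map_mul' x y := by
    rw [← Finset.prod_mul_distrib]
    refine Finset.prod_congr rfl fun a _ => ?_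
    simp only [Units.val_mul, map_mul]
    rw [mul_div_mul_comm]

theorem quotChar_eq_one_iff {n : ℕ} (hn : n < 8) (f e : Fin n → ZMod 8)
    (he : Function.Injective e) :
    A.quotChar f e = 1 ↔ ∃ π : Equiv.Perm (Fin n), f = e ∘ π := by
  have hne : ∀ x : Fˣ, ∏ a, A.T (e a) (x : F) ≠ 0 := fun x =>
    Finset.prod_ne_zero_iff.2 fun a _ => by simp
  constructor
  · intro h
    obtain ⟨π, hπ⟩ := A.exists_perm n hn e f he fun x => by
      have := DFunLike.congr_fun h x
      simp only [quotChar, MonoidHom.coe_mk, OneHom.coe_mk, MonoidHom.one_apply,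
        Finset.prod_div_distrib] at this
      exact (div_eq_one_iff_eq (hne x)).1 this
    exact ⟨π, funext hπ⟩
  · rintro ⟨π, rfl⟩
    ext x
    simp only [quotChar, MonoidHom.coe_mk, OneHom.coe_mk, MonoidHom.one_apply,
        Finset.prod_div_distrib, Function.comp_apply]
    rw [Equiv.prod_comp π fun a => A.T (e a) (x : F), div_self (hne x)]

/-- The coefficients of a composition of linearized polynomials. -/
def comp (b c : ZMod 8 → F) : ZMod 8 → F := fun m => ∑ i, b i * A.T i (c (m - i))

theorem eval_comp (b c : ZMod 8 → F) (x : F) :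
    A.eval (A.comp b c) x = A.eval b (A.eval c x) := by
  rw [A.eval_apply b, A.eval_apply c, A.eval_apply]
  simp only [comp, map_sum, map_mul, Finset.sum_mul, Finset.mul_sum]
  rw [Finset.sum_comm]
  refine Finset.sum_congr rfl fun i _ => ?_
  rw [← Equiv.sum_comp (Equiv.addRight i)]
  refine Finset.sum_congr rfl fun j _ => ?_
  simp only [Equiv.coe_addRight, add_sub_cancel_right]
  rw [add_comm j i, A.add_apply, mul_assoc]

/-- Dedekind independence of characters; the case `n = 1` of `exists_perm` makes the `T i` distinct.
-/
theorem eval_injective : Function.Injective A.eval := by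
  intro b c hbc
  have hinj : Function.Injective (fun i => (A.T i : F →* F)) := by
    intro i j hij
    obtain ⟨π, hπ⟩ := A.exists_perm 1 (by norm_num) (fun _ => j) (fun _ => i)
      (fun a b _ => Subsingleton.elim a b) (fun x => by
        simpa using DFunLike.congr_fun hij (x : F))
    exact hπ 0
  have hli := (linearIndependent_monoidHom F F).comp _ hinj
  rw [Fintype.linearIndependent_iff] at hli
  funext i
  refine sub_eq_zero.1 (hli (fun i => b i - c i) ?_ i)
  funext x
  have := DFunLike.congr_fun hbc x
  simp only [eval_apply] at this
  simp only [Finset.sum_apply, Pi.smul_apply, Function.comp_apply, smul_eq_mul, sub_mul,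
    Finset.sum_sub_distrib, Pi.zero_apply]
  exact sub_eq_zero.2 this

theorem exists_eval_iterate (a : ZMod 8 → F) (n : ℕ) :
    ∃ c : ZMod 8 → F, ∀ x, A.eval c x = (A.eval a)^[n] x := by
  induction n with
  | zero => exact ⟨Pi.single 0 1, fun x => by
      rw [eval_apply, Finset.sum_eq_single 0 (fun i _ hi => by simp [hi]) (by simp)]
      simp [A.zero_apply]⟩
  | succ n ih =>
    obtain ⟨c, hc⟩ := ih
    exact ⟨A.comp c a, fun x => by rw [eval_comp, hc, Function.iterate_succ_apply]⟩

variable [Fintype F]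

/-- A bijective linearized polynomial map has a linearized polynomial inverse. -/
theorem exists_eval_inverse (a : ZMod 8 → F) (ha : ∀ x, A.eval a x = 0 → x = 0) :
    ∃ c : ZMod 8 → F, ∀ x, A.eval c (A.eval a x) = x := by
  classical
  have hinj : Function.Injective (A.eval a) := (injective_iff_map_eq_zero _).2 ha
  let P : Equiv.Perm F := Equiv.ofBijective _ (Finite.injective_iff_bijective.1 hinj)
  -- A permutation of a finite set has a power of itself as its inverse, and iterates of linearized
  -- polynomials are linearized.
  obtain ⟨c, hc⟩ := A.exists_eval_iterate a (orderOf P - 1)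
  refine ⟨c, fun x => ?_⟩
  rw [hc, ← Function.iterate_succ_apply, Nat.succ_eq_add_one,
    Nat.sub_add_cancel (orderOf_pos P)]
  change P^[orderOf P] x = x
  rw [← Equiv.Perm.coe_pow, pow_orderOf_eq_one, Equiv.Perm.one_apply]

variable [DecidableEq F]

theorem sum_quotChar {n : ℕ} (hn : n < 8) (f e : Fin n → ZMod 8)
    (he : Function.Injective e) [Decidable (∃ π : Equiv.Perm (Fin n), f = e ∘ π)] :
    ∑ x : Fˣ, A.quotChar f e x = if ∃ π : Equiv.Perm (Fin n), f = e ∘ π then -1 else 0 := by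
  classical
  rw [sum_hom_units, Fintype.card_units]
  simp only [A.quotChar_eq_one_iff hn f e he]
  have : (1 : ℕ) ≤ Fintype.card F := Fintype.card_pos
  split_ifs <;> simp [Nat.cast_sub this]

/-- Expanding the product gives one character of `Fˣ` for each index map `f`. Only the trivial
characters survive summation, each contributing `-1`, and they are those with `f` a rearrangement of
`e`. -/
theorem sum_prod_eq_neg_permSum {n : ℕ} (hn : n < 8) (b : ZMod 8 → F) (e : Fin n → ZMod 8)
    (he : Function.Injective e) :
    ∑ x : Fˣ, ∏ a, A.T (e a) (A.eval b x / x) = - A.permSum b e := by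
  classical
  have h1 : ∀ x : Fˣ, ∏ a, A.T (e a) (A.eval b x / x)
      = ∑ f : Fin n → ZMod 8, (∏ a, A.T (e a) (b (f a - e a))) * A.quotChar f e x := by
    intro x
    have h2 : ∀ a, A.T (e a) (A.eval b x / x)
        = ∑ i, A.T (e a) (b (i - e a)) * (A.T i (x : F) / A.T (e a) (x : F)) := by
      intro a
      rw [← Equiv.sum_comp (Equiv.addRight (e a)), map_div₀, eval_apply, map_sum,
        Finset.sum_div]
      refine Finset.sum_congr rfl fun i _ => ?_
      simp only [Equiv.coe_addRight, add_sub_cancel_right, map_mul]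
      rw [add_comm i, A.add_apply, mul_div_assoc]
    simp only [h2]
    rw [Finset.prod_univ_sum, Fintype.piFinset_univ]
    refine Finset.sum_congr rfl fun f _ => ?_
    rw [Finset.prod_mul_distrib]
    rfl
  simp only [h1]
  rw [Finset.sum_comm]
  simp only [← Finset.mul_sum, A.sum_quotChar hn _ e he]
  simp only [mul_ite, mul_zero, mul_neg, mul_one]
  rw [← Finset.sum_filter, permSum, ← Finset.sum_neg_distrib]
  symm
  refine Finset.sum_bij (fun π _ => e ∘ π) (fun π _ => by simpa using ⟨π, rfl⟩)
    (fun π _ ρ _ h => ?_) (fun f hf => ?_) (fun π _ => rfl)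
  · ext a
    exact congrArg Fin.val (he (congrFun h a))
  · obtain ⟨π, rfl⟩ := (Finset.mem_filter.1 hf).2
    exact ⟨π, mem_univ _, rfl⟩

/-- Linearized polynomials with the same linear set have the same proper principal permanents. -/
theorem permSum_eq {b g : ZMod 8 → F}
    (hbg : ∀ c, (∃ x, x ≠ 0 ∧ A.eval b x = c * x) ↔ ∃ x, x ≠ 0 ∧ A.eval g x = c * x)
    {n : ℕ} (hn : n < 8) (e : Fin n → ZMod 8) (he : Function.Injective e) :
    A.permSum b e = A.permSum g e := by
  classical
  rw [← neg_inj, ← A.sum_prod_eq_neg_permSum hn b e he, ← A.sum_prod_eq_neg_permSum hn g e he,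
    sum_units_div (A.eval b) (fun c => ∏ a, A.T (e a) c),
    sum_units_div (A.eval g) (fun c => ∏ a, A.T (e a) c)]
  simp only [hbg]

end FrobeniusFamily

/-! ### Base `q` digits modulo `q ^ 8 - 1` -/

theorem eq_of_sum_mul_pow_eq {q : ℕ} (c d : Fin 8 → ℕ) (hc : ∀ i, c i < q) (hd : ∀ i, d i < q)
    (h : ∑ i, c i * q ^ (i : ℕ) = ∑ i, d i * q ^ (i : ℕ)) : c = d := by
  have h1 : (finFunctionFinEquiv (fun i => (⟨c i, hc i⟩ : Fin q)) : Fin (q ^ 8))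
      = finFunctionFinEquiv (fun i => (⟨d i, hd i⟩ : Fin q)) := by
    ext
    simpa [finFunctionFinEquiv_apply] using h
  funext i
  simpa using congrFun (finFunctionFinEquiv.injective h1) i

theorem sum_mul_pow_lt {q : ℕ} (c : Fin 8 → ℕ) (hc : ∀ i, c i < q) :
    ∑ i, c i * q ^ (i : ℕ) < q ^ 8 := by
  have := (finFunctionFinEquiv (fun i => (⟨c i, hc i⟩ : Fin q)) : Fin (q ^ 8)).isLt
  simpa [finFunctionFinEquiv_apply] using this

theorem sum_pred_mul_pow (q : ℕ) (hq : 2 ≤ q) :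
    ∑ i : Fin 8, (q - 1) * q ^ (i : ℕ) = q ^ 8 - 1 := by
  rw [← Finset.mul_sum, Fin.sum_univ_eq_sum_range (fun i => q ^ i), mul_comm,
    Nat.geomSum_eq hq, Nat.div_mul_cancel (Nat.sub_one_dvd_pow_sub_one q 8)]

/-- The only digit string reaching `q ^ 8 - 1` has all digits `q - 1`, and its digit sum is at least
8. -/
theorem sum_mul_pow_lt_pred {q : ℕ} (hq : 2 ≤ q) (c : Fin 8 → ℕ) (hc : ∀ i, c i < q)
    (hs : ∑ i, c i < 8) : ∑ i, c i * q ^ (i : ℕ) < q ^ 8 - 1 := by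
  refine lt_of_le_of_ne (Nat.le_sub_one_of_lt (sum_mul_pow_lt c hc)) fun h => ?_
  rw [← sum_pred_mul_pow q hq] at h
  have h1 := eq_of_sum_mul_pow_eq c (fun _ => q - 1) hc (fun _ => by omega) h
  subst h1
  simp at hs
  omega

/-- Trade `q` units at position `i` for one at the cyclically next position; the digit sum drops by
`q - 1`. -/
theorem exists_carry {q : ℕ} (hq : 2 ≤ q) (c : Fin 8 → ℕ) (i : Fin 8) (hi : q ≤ c i) :
    ∃ c' : Fin 8 → ℕ, ∑ j, c' j < ∑ j, c j ∧
      ∑ j, c' j * q ^ (j : ℕ) ≡ ∑ j, c j * q ^ (j : ℕ) [MOD (q ^ 8 - 1)] := by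
  let r : Fin 8 → ℕ := fun j => if j = i then c i - q else c j
  have hcr : ∀ j, c j = r j + if j = i then q else 0 := by
    intro j
    by_cases hj : j = i
    · subst hj; simp [r]; omega
    · simp [r, hj]
  refine ⟨fun j => r j + if j = i + 1 then 1 else 0, ?_, ?_⟩
  · simp only [hcr, Finset.sum_add_distrib, Finset.sum_ite_eq', Finset.mem_univ, if_true]
    omega
  · simp only [hcr, add_mul, Finset.sum_add_distrib, ite_mul, zero_mul, one_mul,
      Finset.sum_ite_eq', Finset.mem_univ, if_true]
    refine Nat.ModEq.add_left _ ?_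
    rw [← pow_succ']
    -- From the top position the carry wraps around to position 0, since `q ^ 8` is 1 modulo `q ^ 8
    -- - 1`.
    by_cases h7 : i = 7
    · subst h7
      have : 1 ≤ q ^ 8 := Nat.one_le_pow _ _ (by omega)
      refine (Nat.modEq_iff_dvd' (by simpa using this)).2 ?_
      simp
    · have : ((i + 1 : Fin 8) : ℕ) = i + 1 := by
        clear hcr r hi; revert i; decide
      rw [this]

/-- Sums of powers of `q` of minimal length are determined modulo `q ^ 8 - 1`. -/
theorem eq_of_sum_mul_pow_modEq {q : ℕ} (hq : 2 ≤ q) (d : Fin 8 → ℕ) (hd : ∀ i, d i ≤ 1)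
    (hs : ∑ i, d i < 8) (n : ℕ) : ∀ c : Fin 8 → ℕ, ∑ i, c i = n → n ≤ ∑ i, d i →
    ∑ i, c i * q ^ (i : ℕ) ≡ ∑ i, d i * q ^ (i : ℕ) [MOD (q ^ 8 - 1)] → c = d := by
  induction n using Nat.strong_induction_on with
  | _ n ih =>
    intro c hcn hn h
    by_cases hc : ∀ i, c i < q
    · have hd' : ∀ i, d i < q := fun i => lt_of_le_of_lt (hd i) hq
      exact eq_of_sum_mul_pow_eq c d hc hd' (h.eq_of_lt_of_lt
        (sum_mul_pow_lt_pred hq c hc (by omega)) (sum_mul_pow_lt_pred hq d hd' hs))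
    -- A carry would give a congruent string which is `d` by induction, yet has digit sum smaller
    -- than that of `d`.
    · push Not at hc
      obtain ⟨i, hi⟩ := hc
      obtain ⟨c', h1, h2⟩ := exists_carry hq c i hi
      have := ih _ (hcn ▸ h1) c' rfl (by omega) (h2.trans h)
      subst this
      omega

/-- Evaluating at a generator of `Fˣ` gives a congruence of exponents modulo `q ^ 8 - 1`, whose
digits are the multiplicities `μ` of the indices. -/
theorem exists_perm_of_prod_pow_eq {F : Type*} [Field F] [Fintype F] {q : ℕ} (hq : 2 ≤ q)
    (hF : Fintype.card F = q ^ 8) {n : ℕ} (hn : n < 8) (e f : Fin n → ZMod 8)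
    (he : Function.Injective e)
    (h : ∀ x : Fˣ, ∏ a, (x : F) ^ q ^ (f a).val = ∏ a, (x : F) ^ q ^ (e a).val) :
    ∃ π : Equiv.Perm (Fin n), ∀ a, f a = e (π a) := by
  classical
  obtain ⟨u, hu⟩ := IsCyclic.exists_generator (α := Fˣ)
  have hord : orderOf u = q ^ 8 - 1 := by
    rw [orderOf_eq_card_of_forall_mem_zpowers hu, Nat.card_eq_fintype_card, Fintype.card_units, hF]
  have hmod : ∑ a, q ^ (f a).val ≡ ∑ a, q ^ (e a).val [MOD (q ^ 8 - 1)] := by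
    rw [← hord, ← pow_eq_pow_iff_modEq]
    have := h u
    rw [Finset.prod_pow_eq_pow_sum, Finset.prod_pow_eq_pow_sum] at this
    exact Units.ext (by simpa using this)
  obtain ⟨μ, hμ⟩ : ∃ μ : (Fin n → ZMod 8) → ZMod 8 → ℕ, ∀ g i, μ g i = #{a | g a = i} :=
    ⟨fun g i => #{a | g a = i}, fun _ _ => rfl⟩
  have hcount : ∀ g : Fin n → ZMod 8, ∑ a, q ^ (g a).val = ∑ i : ZMod 8, μ g i * q ^ i.val := by
    intro g
    rw [← Finset.sum_fiberwise (univ : Finset (Fin n)) g]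
    refine Finset.sum_congr rfl fun i _ => ?_
    rw [hμ, ← smul_eq_mul, ← Finset.sum_const]
    refine Finset.sum_congr rfl fun a ha => ?_
    rw [(Finset.mem_filter.1 ha).2]
  have hcard : ∀ g : Fin n → ZMod 8, ∑ i, μ g i = n := fun g => by
    have := Finset.card_eq_sum_card_fiberwise (f := g) (s := univ) (t := univ) (by simp)
    simp only [hμ]
    rw [← this, Finset.card_univ, Fintype.card_fin]
  rw [hcount, hcount] at hmod
  have hle : ∀ i, μ e i ≤ 1 := fun i => by
    rw [hμ]
    refine Finset.card_le_one.2 fun a ha b hb => ?_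
    simp only [Finset.mem_filter, Finset.mem_univ, true_and] at ha hb
    exact he (ha.trans hb.symm)
  have hcd : μ f = μ e := eq_of_sum_mul_pow_modEq hq (μ e) hle
    ((hcard e).trans_lt hn) n (μ f) (hcard f) (hcard e).ge hmod
  have hex : ∀ a, ∃ b, e b = f a := by
    intro a
    have h1 : 0 < #{b | f b = f a} := Finset.card_pos.2 ⟨a, by simp⟩
    have h2 := congrFun hcd (f a)
    rw [hμ, hμ] at h2
    rw [h2] at h1
    obtain ⟨b, hb⟩ := Finset.card_pos.1 h1
    exact ⟨b, (Finset.mem_filter.1 hb).2⟩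
  choose p hp using hex
  have hf : Function.Injective f := by
    intro a b hab
    have h3 := hle (f a)
    rw [← hcd, hμ] at h3
    exact Finset.card_le_one.1 h3 a (by simp) b (by simp [hab])
  have hpi : Function.Injective p := fun a b hab => hf (by rw [← hp, ← hp, hab])
  exact ⟨Equiv.ofBijective p (Finite.injective_iff_bijective.1 hpi), fun a => (hp a).symm⟩

/-- The powers of `x ↦ x ^ q ^ s`, for a unit `s` modulo `8`. -/
theorem exists_frobeniusFamily {F : Type*} [Field F] [Fintype F] {q : ℕ} (hq : IsPrimePow q)
    (hF : Fintype.card F = q ^ 8) (s : ZMod 8) (hs : s * s = 1) :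
    ∃ A : FrobeniusFamily F, ∀ i x, A.T i x = x ^ q ^ (s * i).val := by
  have hq2 : 2 ≤ q := hq.two_le
  obtain ⟨p, k, hp, hk, rfl⟩ := hq
  have hp' := hp.nat_prime
  have : Fact p.Prime := ⟨hp'⟩
  have : CharP F p := by
    obtain ⟨p', _⟩ := CharP.exists F
    obtain ⟨m, hp'', hm⟩ := FiniteField.card F p'
    have : p ∣ p' ^ (m : ℕ) := by
      rw [← hm, hF, ← pow_mul]; exact dvd_pow_self _ (by omega)
    have := (Nat.prime_dvd_prime_iff_eq hp' hp'').1 (hp'.dvd_of_dvd_pow this)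
    subst this
    assumption
  have hpow : ∀ (i : ℕ) (x : F), iterateFrobenius F p (k * i) x = x ^ (p ^ k) ^ i := by
    intro i x; rw [iterateFrobenius_def, pow_mul]
  have hmod : ∀ (x : F) (m : ℕ), x ^ (p ^ k) ^ (m % 8) = x ^ (p ^ k) ^ m := by
    intro x m
    conv_rhs => rw [← Nat.mod_add_div m 8, pow_add, pow_mul, pow_mul]
    rw [← hF, FiniteField.pow_card_pow]
  refine ⟨⟨fun i => iterateFrobenius F p (k * (s * i).val), fun x => by simp, ?_, ?_⟩,
    fun i x => hpow _ x⟩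
  · intro i j x
    rw [hpow, hpow, hpow, mul_add, ZMod.val_add, hmod, ← pow_mul x, add_comm, pow_add]
  · intro n hn e f he h
    simp only [hpow] at h
    obtain ⟨π, hπ⟩ := exists_perm_of_prod_pow_eq hq2 hF hn (fun a => s * e a) (fun a => s * f a)
      (fun a b hab => he (by
        have := congrArg (s * ·) hab
        simpa only [← mul_assoc, hs, one_mul] using this)) h
    refine ⟨π, fun a => ?_⟩
    have := congrArg (s * ·) (hπ a)
    simpa only [← mul_assoc, hs, one_mul] using this

/-! ### Vanishing coefficients read off from small permanents -/

namespace FrobeniusFamily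

variable {F : Type*} [Field F] (A : FrobeniusFamily F)

section Permanents

variable {b : ZMod 8 → F}

theorem permSum_eq_single {n : ℕ} (e : Fin n → ZMod 8) (ρ : Equiv.Perm (Fin n))
    (h : ∀ π, π ≠ ρ → ∃ a, b (e (π a) - e a) = 0) :
    A.permSum b e = ∏ a, A.T (e a) (b (e (ρ a) - e a)) := by
  rw [permSum, Finset.sum_eq_single ρ _ (by simp)]
  intro π _ hπ
  obtain ⟨a, ha⟩ := h π hπ
  exact Finset.prod_eq_zero (mem_univ a) (by rw [ha, map_zero])

theorem permSum_eq_zero {n : ℕ} (e : Fin n → ZMod 8)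
    (h : ∀ π : Equiv.Perm (Fin n), ∃ a, b (e (π a) - e a) = 0) : A.permSum b e = 0 := by
  refine Finset.sum_eq_zero fun π _ => ?_
  obtain ⟨a, ha⟩ := h π
  exact Finset.prod_eq_zero (mem_univ a) (by rw [ha, map_zero])

theorem permSum_zero : A.permSum b ![0] = b 0 := by
  rw [A.permSum_eq_single _ 1 (fun π hπ => (hπ (Subsingleton.elim _ _)).elim)]
  simp [A.zero_apply]

theorem permSum_pair (hb : b 0 = 0) (i : ZMod 8) :
    A.permSum b ![0, i] = b i * A.T i (b (-i)) := by
  rw [A.permSum_eq_single _ (Equiv.swap 0 1)]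
  · simp [Fin.prod_univ_two, A.zero_apply]
  · intro π hπ
    refine ⟨0, ?_⟩
    have h1 : ∀ π : Equiv.Perm (Fin 2), π ≠ Equiv.swap 0 1 → π 0 = 0 := by decide
    rw [h1 π hπ, sub_self, hb]

theorem exists_apply_eq_zero {n : ℕ} {e : Fin n → ZMod 8} {S : Finset (ZMod 8)}
    (hb : ∀ i ∈ S, b i = 0) {π : Equiv.Perm (Fin n)} (h : ∃ a, e (π a) - e a ∈ S) :
    ∃ a, b (e (π a) - e a) = 0 := by
  obtain ⟨a, ha⟩ := h
  exact ⟨a, hb _ ha⟩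

/-- The known zeros of `b` kill every term of the permanent but that of `ρ`, so a vanishing
permanent produces a new zero of `b`. -/
theorem exists_eq_zero_of_permSum_eq_zero {n : ℕ} (e : Fin n → ZMod 8) (S : Finset (ZMod 8))
    (ρ : Equiv.Perm (Fin n)) (hb : ∀ i ∈ S, b i = 0) (h0 : A.permSum b e = 0)
    (hρ : ∀ π, π ≠ ρ → ∃ a, e (π a) - e a ∈ S) : ∃ a, b (e (ρ a) - e a) = 0 := by
  rw [A.permSum_eq_single e ρ fun π hπ => exists_apply_eq_zero hb (hρ π hπ),
    Finset.prod_eq_zero_iff] at h0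
  obtain ⟨a, -, ha⟩ := h0
  exact ⟨a, (map_eq_zero _).1 ha⟩

/-- `b` and `g` have the same proper principal permanents. -/
def SamePermSums (b g : ZMod 8 → F) : Prop :=
  ∀ (n : ℕ), n < 8 → ∀ e : Fin n → ZMod 8, Function.Injective e → A.permSum b e = A.permSum g e

variable {A} {g : ZMod 8 → F}

theorem SamePermSums.zero (H : A.SamePermSums b g) (hg : g 0 = 0) : b 0 = 0 := by
  rw [← A.permSum_zero (b := b), H 1 (by norm_num) _ (fun a b _ => Subsingleton.elim a b),
    A.permSum_zero, hg]

theorem SamePermSums.pair (H : A.SamePermSums b g) (hg : g 0 = 0) (i : ZMod 8) (hi : i ≠ 0) :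
    b i * A.T i (b (-i)) = g i * A.T i (g (-i)) := by
  rw [← A.permSum_pair hg, ← A.permSum_pair (H.zero hg)]
  refine H 2 (by norm_num) _ ?_
  clear H
  revert i
  decide

theorem SamePermSums.pair_eq_zero (H : A.SamePermSums b g) (hg : g 0 = 0) (i : ZMod 8)
    (hi : i ≠ 0) (h : g i = 0 ∨ g (-i) = 0) : b i = 0 ∨ b (-i) = 0 := by
  have h1 := H.pair hg i hi
  rw [show g i * A.T i (g (-i)) = 0 by rcases h with h | h <;> simp [h], mul_eq_zero,
    map_eq_zero] at h1
  exact h1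

/-- Permanents of order 1 and 2 leave only one of `b 2`, `b 6` possibly nonzero. The permanent on
the subgroup of even indices is then a product of conjugates of that coefficient. -/
theorem SamePermSums.even (H : A.SamePermSums b g)
    (hg : ∀ i ∈ ({0, 2, 4, 6} : Finset (ZMod 8)), g i = 0) :
    ∀ i ∈ ({0, 2, 4, 6} : Finset (ZMod 8)), b i = 0 := by
  have g0 := hg 0 (by decide)
  have b0 := H.zero g0
  have b4 : b 4 = 0 := (or_self_iff).1
    (H.pair_eq_zero g0 4 (by decide) (Or.inl (hg 4 (by decide))))
  have key : ∀ k ∈ ({2, 6} : Finset (ZMod 8)), b (-k) = 0 → b k = 0 := by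
    intro k hk hbk
    have hinj : ∀ k ∈ ({2, 6} : Finset (ZMod 8)),
        Function.Injective (![0, k, 2 * k, 3 * k] : Fin 4 → ZMod 8) := by decide
    have hev : ∀ k ∈ ({2, 6} : Finset (ZMod 8)), ∀ a c : Fin 4,
        (![0, k, 2 * k, 3 * k] : Fin 4 → ZMod 8) c - (![0, k, 2 * k, 3 * k] : Fin 4 → ZMod 8) a
          ∈ ({0, 2, 4, 6} : Finset (ZMod 8)) := by decide
    have hrot : ∀ k ∈ ({2, 6} : Finset (ZMod 8)), ∀ π : Equiv.Perm (Fin 4), π ≠ finRotate 4 →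
        ∃ a, (![0, k, 2 * k, 3 * k] : Fin 4 → ZMod 8) (π a)
          - (![0, k, 2 * k, 3 * k] : Fin 4 → ZMod 8) a ∈ ({0, 4, -k} : Finset (ZMod 8)) := by
      decide
    have hstep : ∀ k ∈ ({2, 6} : Finset (ZMod 8)), ∀ a : Fin 4,
        (![0, k, 2 * k, 3 * k] : Fin 4 → ZMod 8) (finRotate 4 a)
          - (![0, k, 2 * k, 3 * k] : Fin 4 → ZMod 8) a = k := by decide
    have h0 := H 4 (by norm_num) _ (hinj k hk)
    rw [A.permSum_eq_zero (b := g) _ fun π => ⟨0, hg _ (hev k hk _ _)⟩] at h0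
    obtain ⟨a, ha⟩ := A.exists_eq_zero_of_permSum_eq_zero _ {0, 4, -k} (finRotate 4) (by
      intro i hi
      simp only [Finset.mem_insert, Finset.mem_singleton] at hi
      rcases hi with rfl | rfl | rfl <;> assumption) h0 (hrot k hk)
    rwa [hstep k hk] at ha
  have h26 : b 2 = 0 ∧ b 6 = 0 := by
    rcases H.pair_eq_zero g0 2 (by decide) (Or.inl (hg 2 (by decide))) with h | h
    · exact ⟨h, key 6 (by decide) h⟩
    · exact ⟨key 2 (by decide) h, h⟩
  intro i hi
  simp only [Finset.mem_insert, Finset.mem_singleton] at hi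
  rcases hi with rfl | rfl | rfl | rfl
  exacts [b0, h26.1, b4, h26.2]

/-- The coefficients vanish at the even indices and at two of the odd ones. -/
def IsOddBinomial (b : ZMod 8 → F) : Prop :=
  (∀ i ∈ ({0, 2, 4, 6} : Finset (ZMod 8)), b i = 0) ∧
    ∃ k ∈ ({1, 3, 5, 7} : Finset (ZMod 8)), ∃ l ∈ ({1, 3, 5, 7} : Finset (ZMod 8)),
      k ≠ l ∧ b k = 0 ∧ b l = 0

/-- Each of the pairs `{1, -1}` and `{3, -3}` contains an index outside `{k, k + 4}`, so the order 2
permanents of `b` force a zero in each pair. -/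
theorem SamePermSums.isOddBinomial_of_add_four (H : A.SamePermSums b g) {k : ZMod 8}
    (hk : k ∈ ({1, 3, 5, 7} : Finset (ZMod 8))) (hg : ∀ i, i ≠ k → i ≠ k + 4 → g i = 0) :
    IsOddBinomial b := by
  have hev : ∀ k ∈ ({1, 3, 5, 7} : Finset (ZMod 8)), ∀ i ∈ ({0, 2, 4, 6} : Finset (ZMod 8)),
      i ≠ k ∧ i ≠ k + 4 := by decide
  have hodd : ∀ k ∈ ({1, 3, 5, 7} : Finset (ZMod 8)), ∀ i ∈ ({1, 3} : Finset (ZMod 8)),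
      (i ≠ k ∧ i ≠ k + 4) ∨ (-i ≠ k ∧ -i ≠ k + 4) := by decide
  have hge : ∀ i ∈ ({0, 2, 4, 6} : Finset (ZMod 8)), g i = 0 := fun i hi =>
    hg i (hev k hk i hi).1 (hev k hk i hi).2
  have hz : ∀ i ∈ ({1, 3} : Finset (ZMod 8)), b i = 0 ∨ b (-i) = 0 := fun i hi =>
    H.pair_eq_zero (hge 0 (by decide)) i (by revert i; decide)
      ((hodd k hk i hi).imp (fun h => hg _ h.1 h.2) fun h => hg _ h.1 h.2)
  refine ⟨H.even hge, ?_⟩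
  rcases hz 1 (by decide) with h1 | h1 <;> rcases hz 3 (by decide) with h3 | h3
  exacts [⟨1, by decide, 3, by decide, by decide, h1, h3⟩,
    ⟨1, by decide, -3, by decide, by decide, h1, h3⟩,
    ⟨-1, by decide, 3, by decide, by decide, h1, h3⟩,
    ⟨-1, by decide, -3, by decide, by decide, h1, h3⟩]

/-- The order 2 permanents give `b k, b (-k) ≠ 0` and a zero among `b (3 * k)`, `b (-(3 * k))`; one
of order 4 makes the other vanish too. -/
theorem SamePermSums.isOddBinomial_of_neg (H : A.SamePermSums b g) {k : ZMod 8}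
    (hk : k ∈ ({1, 3, 5, 7} : Finset (ZMod 8))) (hg : ∀ i, i ≠ k → i ≠ -k → g i = 0)
    (hgk : g k ≠ 0) (hgk' : g (-k) ≠ 0) : IsOddBinomial b := by
  have hev : ∀ k ∈ ({1, 3, 5, 7} : Finset (ZMod 8)), ∀ i ∈ ({0, 2, 4, 6} : Finset (ZMod 8)),
      i ≠ k ∧ i ≠ -k := by decide
  have hge : ∀ i ∈ ({0, 2, 4, 6} : Finset (ZMod 8)), g i = 0 := fun i hi =>
    hg i (hev k hk i hi).1 (hev k hk i hi).2
  have hbe := H.even hge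
  have hk0 : ∀ k ∈ ({1, 3, 5, 7} : Finset (ZMod 8)), k ≠ 0 ∧ 3 * k ≠ 0 ∧ -k ∈
    ({1, 3, 5, 7} : Finset (ZMod 8)) ∧ 3 * k ≠ k ∧ 3 * k ≠ -k ∧ 3 * k ∈
    ({1, 3, 5, 7} : Finset (ZMod 8)) ∧ -(3 * k) ∈ ({1, 3, 5, 7} : Finset (ZMod 8)) ∧
    3 * k ≠ -(3 * k) := by decide
  obtain ⟨k0, k3, kn, hk3, hk3', h3m, h3m', hne⟩ := hk0 k hk
  have hbk : b k ≠ 0 ∧ b (-k) ≠ 0 := by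
    have h1 := H.pair (hge 0 (by decide)) k k0
    constructor <;> intro h2
    · rw [h2, zero_mul] at h1
      exact mul_ne_zero hgk ((map_ne_zero _).2 hgk') h1.symm
    · rw [h2, map_zero, mul_zero] at h1
      exact mul_ne_zero hgk ((map_ne_zero _).2 hgk') h1.symm
  have key : ∀ m ∈ ({k, -k} : Finset (ZMod 8)), b (-(3 * m)) = 0 → b (3 * m) = 0 := by
    intro m hm hbm
    have hm4 : m ∈ ({1, 3, 5, 7} : Finset (ZMod 8)) := by
      rw [Finset.mem_insert, Finset.mem_singleton] at hm
      rcases hm with rfl | rfl <;> assumption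
    have hgm : ∀ i, i ≠ m → i ≠ -m → g i = 0 := by
      rw [Finset.mem_insert, Finset.mem_singleton] at hm
      rcases hm with rfl | rfl
      · exact hg
      · intro i h1 h2
        exact hg i (by simpa using h2) h1
    have hbm0 : b m ≠ 0 := by
      rw [Finset.mem_insert, Finset.mem_singleton] at hm
      rcases hm with rfl | rfl
      exacts [hbk.1, hbk.2]
    -- The cycle through `0, m, 2m, 5m` has steps `m, m, 3m, 3m`, and every other permutation meets
    -- a known zero of `b`. For `g` the row of `5m` is zero, as no difference there is `±m`.
    have hinj : ∀ k ∈ ({1, 3, 5, 7} : Finset (ZMod 8)),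
        Function.Injective (![0, k, 2 * k, 5 * k] : Fin 4 → ZMod 8) := by decide
    have hgz : ∀ k ∈ ({1, 3, 5, 7} : Finset (ZMod 8)), ∀ c : Fin 4,
        (![0, k, 2 * k, 5 * k] : Fin 4 → ZMod 8) c - (![0, k, 2 * k, 5 * k] : Fin 4 → ZMod 8) 3 ≠ k
        ∧ (![0, k, 2 * k, 5 * k] : Fin 4 → ZMod 8) c
          - (![0, k, 2 * k, 5 * k] : Fin 4 → ZMod 8) 3 ≠ -k := by decide
    have hrot : ∀ k ∈ ({1, 3, 5, 7} : Finset (ZMod 8)), ∀ π : Equiv.Perm (Fin 4),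
        π ≠ finRotate 4 → ∃ a, (![0, k, 2 * k, 5 * k] : Fin 4 → ZMod 8) (π a)
          - (![0, k, 2 * k, 5 * k] : Fin 4 → ZMod 8) a
            ∈ insert (-(3 * k)) ({0, 2, 4, 6} : Finset (ZMod 8)) := by
      decide
    have hstep : ∀ k ∈ ({1, 3, 5, 7} : Finset (ZMod 8)), ∀ a : Fin 4,
        (![0, k, 2 * k, 5 * k] : Fin 4 → ZMod 8) (finRotate 4 a)
          - (![0, k, 2 * k, 5 * k] : Fin 4 → ZMod 8) a = k ∨
        (![0, k, 2 * k, 5 * k] : Fin 4 → ZMod 8) (finRotate 4 a)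
          - (![0, k, 2 * k, 5 * k] : Fin 4 → ZMod 8) a = 3 * k := by decide
    have h0 := H 4 (by norm_num) _ (hinj m hm4)
    rw [A.permSum_eq_zero (b := g) _ fun π => ⟨3, hgm _ (hgz m hm4 _).1 (hgz m hm4 _).2⟩] at h0
    obtain ⟨a, ha⟩ := A.exists_eq_zero_of_permSum_eq_zero _ (insert (-(3 * m)) {0, 2, 4, 6})
      (finRotate 4) (by
        intro i hi
        rcases Finset.mem_insert.1 hi with rfl | hi
        exacts [hbm, hbe i hi]) h0 (hrot m hm4)
    rcases hstep m hm4 a with h | h <;> rw [h] at ha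
    exacts [(hbm0 ha).elim, ha]
  refine ⟨hbe, 3 * k, h3m, -(3 * k), h3m', hne, ?_⟩
  rcases H.pair_eq_zero (hge 0 (by decide)) (3 * k) k3 (Or.inl (hg _ hk3 hk3')) with h | h
  · exact ⟨h, by simpa using key (-k) (by simp) (by simpa using h)⟩
  · exact ⟨key k (by simp) h, h⟩

end Permanents


/-! ### Composing odd binomials with `ψ` -/

theorem sum_zmod_eight (f : ZMod 8 → F) :
    ∑ i, f i = f 0 + f 1 + f 2 + f 3 + f 4 + f 5 + f 6 + f 7 :=
  Fin.sum_univ_eight f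

/-- The coefficients of `ψ_{h,4,s}` with respect to the powers of `x ↦ x ^ q ^ s`. -/
def psiCoeff (h : F) (i : ZMod 8) : F :=
  if i = 1 then 1 else if i = 3 then 1 else if i = 5 then h * A.T 1 h else
    if i = 7 then h / A.T 7 h else 0

theorem psiCoeff_even (h : F) {i : ZMod 8} (hi : i ∈ ({0, 2, 4, 6} : Finset (ZMod 8))) :
    A.psiCoeff h i = 0 := by
  simp only [Finset.mem_insert, Finset.mem_singleton] at hi
  rcases hi with rfl | rfl | rfl | rfl <;> rfl

/-- An odd binomial composed with `ψ` is a scalar multiple of the identity only if it is zero. -/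
theorem comp_psiCoeff_zero_eq_zero {h : F} (hh : h * A.T 4 h = -1) {u : ZMod 8 → F}
    (hu : ∃ k ∈ ({1, 3, 5, 7} : Finset (ZMod 8)), ∃ l ∈ ({1, 3, 5, 7} : Finset (ZMod 8)),
      k ≠ l ∧ u k = 0 ∧ u l = 0) (hue : ∀ i ∈ ({0, 2, 4, 6} : Finset (ZMod 8)), u i = 0)
    (h2 : A.comp u (A.psiCoeff h) 2 = 0) (h4 : A.comp u (A.psiCoeff h) 4 = 0)
    (h6 : A.comp u (A.psiCoeff h) 6 = 0) : A.comp u (A.psiCoeff h) 0 = 0 := by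
  have hT : ∀ i j x, A.T i (A.T j x) = A.T (i + j) x := fun i j x => (A.add_apply i j x).symm
  have expand : ∀ m : ZMod 8, A.comp u (A.psiCoeff h) m
      = u 1 * A.T 1 (A.psiCoeff h (m - 1)) + u 3 * A.T 3 (A.psiCoeff h (m - 3))
        + u 5 * A.T 5 (A.psiCoeff h (m - 5)) + u 7 * A.T 7 (A.psiCoeff h (m - 7)) := by
    intro m
    rw [comp, sum_zmod_eight, hue 0 (by decide), hue 2 (by decide), hue 4 (by decide),
      hue 6 (by decide)]
    ring
  have H0 : h ≠ 0 := by rintro rfl; simp at hh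
  -- The relation `hh` expresses the conjugates 4 to 7 through `h, H1, H2, H3`, so the four
  -- coefficients become linear forms in `u 1, u 3, u 5, u 7`.
  obtain ⟨H1, e1⟩ : ∃ z, A.T 1 h = z := ⟨_, rfl⟩
  obtain ⟨H2, e2⟩ : ∃ z, A.T 2 h = z := ⟨_, rfl⟩
  obtain ⟨H3, e3⟩ : ∃ z, A.T 3 h = z := ⟨_, rfl⟩
  have n1 : H1 ≠ 0 := e1 ▸ (map_ne_zero _).2 H0
  have n2 : H2 ≠ 0 := e2 ▸ (map_ne_zero _).2 H0
  have n3 : H3 ≠ 0 := e3 ▸ (map_ne_zero _).2 H0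
  have e4 : A.T 4 h = -1 / h := by field_simp; linear_combination hh
  have e5 : A.T 5 h = -1 / H1 := by
    rw [← e1, ← map_one (A.T 1), ← map_neg, ← map_div₀, ← e4, hT]; rfl
  have e6 : A.T 6 h = -1 / H2 := by
    rw [← e2, ← map_one (A.T 2), ← map_neg, ← map_div₀, ← e4, hT]; rfl
  have e7 : A.T 7 h = -1 / H3 := by
    rw [← e3, ← map_one (A.T 3), ← map_neg, ← map_div₀, ← e4, hT]; rfl
  have t0 : A.T 0 h = h := A.zero_apply h
  have E2 : u 1 + u 3 * (H3 / H2) + u 5 * (1 / (H1 * H2)) + u 7 = 0 := by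
    rw [expand] at h2
    change u 1 * A.T 1 1 + u 3 * A.T 3 (h / A.T 7 h) + u 5 * A.T 5 (h * A.T 1 h)
      + u 7 * A.T 7 1 = 0 at h2
    simp only [map_one, map_div₀, map_mul, hT] at h2
    change u 1 * 1 + u 3 * (A.T 3 h / A.T 2 h) + u 5 * (A.T 5 h * A.T 6 h) + u 7 * 1 = 0 at h2
    rw [e2, e3, e5, e6] at h2
    rw [← h2]; field_simp
  have E4 : u 1 + u 3 + u 5 * (h / H1) - u 7 * (h / H3) = 0 := by
    rw [expand] at h4
    change u 1 * A.T 1 1 + u 3 * A.T 3 1 + u 5 * A.T 5 (h / A.T 7 h)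
      + u 7 * A.T 7 (h * A.T 1 h) = 0 at h4
    simp only [map_one, map_div₀, map_mul, hT] at h4
    change u 1 * 1 + u 3 * 1 + u 5 * (A.T 5 h / A.T 4 h) + u 7 * (A.T 7 h * A.T 0 h) = 0 at h4
    rw [e4, e5, e7, t0] at h4
    rw [← h4]; field_simp; ring
  have E6 : u 1 * (H1 * H2) + u 3 + u 5 + u 7 * (H2 / H3) = 0 := by
    rw [expand] at h6
    change u 1 * A.T 1 (h * A.T 1 h) + u 3 * A.T 3 1 + u 5 * A.T 5 1
      + u 7 * A.T 7 (h / A.T 7 h) = 0 at h6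
    simp only [map_one, map_div₀, map_mul, hT] at h6
    change u 1 * (A.T 1 h * A.T 2 h) + u 3 * 1 + u 5 * 1 + u 7 * (A.T 7 h / A.T 6 h) = 0 at h6
    rw [e1, e2, e6, e7] at h6
    rw [← h6]; field_simp
  have E0 : A.comp u (A.psiCoeff h) 0 = u 1 * (H1 / h) - u 3 * (H3 / h) + u 5 + u 7 := by
    rw [expand]
    change u 1 * A.T 1 (h / A.T 7 h) + u 3 * A.T 3 (h * A.T 1 h) + u 5 * A.T 5 1
      + u 7 * A.T 7 1 = _
    simp only [map_one, map_div₀, map_mul, hT]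
    change u 1 * (A.T 1 h / A.T 0 h) + u 3 * (A.T 3 h * A.T 4 h) + u 5 * 1 + u 7 * 1 = _
    rw [e1, e3, e4, t0]
    field_simp; ring
  rw [E0]
  clear E0 expand h2 h4 h6 hue
  -- All conjugates of `h` agree and `h ^ 2 = 1 = -1`.
  have close : H1 = h → h * h = 1 →
      u 1 * (H1 / h) - u 3 * (H3 / h) + u 5 + u 7 = 0 := by
    intro ha hb
    have hc : A.T 1 h = h := e1.trans ha
    have hd : H2 = h := by
      rw [← e2, show A.T 2 h = A.T 1 (A.T 1 h) from A.add_apply 1 1 h, hc, hc]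
    have he : H3 = h := by
      rw [← e3, show A.T 3 h = A.T 1 (A.T 2 h) from A.add_apply 1 2 h, e2, hd, hc]
    have hf : (1 : F) = -1 := by
      have : A.T 4 h = h := by
        rw [show A.T 4 h = A.T 1 (A.T 3 h) from A.add_apply 1 3 h, e3, he, hc]
      rw [← hh, this, hb]
    rw [ha, he, div_self H0] at E4
    rw [ha, he, div_self H0]
    linear_combination E4 + (u 7 - u 3) * hf
  -- A relation between conjugates of `h` may be shifted.
  have shift13 : H1 * H3 = 1 → h * H2 = 1 := by
    intro h13
    rw [← t0, ← e2, ← map_one (A.T 7), ← h13, ← e1, ← e3, map_mul, hT, hT]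
    rfl
  have shift02 : h * H2 = 1 → H2 * (-1 / h) = 1 := by
    intro h02
    rw [← e4, ← e2, ← map_one (A.T 2), ← h02, ← e2, map_mul, hT]
    rfl
  have sq_of_13 : H1 * H3 = 1 → h * h = -1 := by
    intro h13
    have ha := shift13 h13
    have hb := shift02 ha
    field_simp at hb
    linear_combination -h * hb - ha
  -- In the supports {1, 3}, {1, 7}, {3, 5} and {5, 7}, a nonzero solution forces the degenerate
  -- situation of `close`.
  have c13 : u 5 = 0 → u 7 = 0 → u 1 * (H1 / h) - u 3 * (H3 / h) + u 5 + u 7 = 0 := by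
    intro u5 u7
    simp only [u5, u7, zero_mul, add_zero, sub_zero] at E2 E4 E6
    have u3 : u 3 = -u 1 := by linear_combination E4
    by_cases u1 : u 1 = 0
    · simp [u5, u7, u3, u1]
    have a12 : H1 * H2 = 1 := mul_left_cancel₀ u1 (by linear_combination E6 - u3)
    have a23 : H2 = H3 := by
      rw [u3] at E2
      field_simp at E2
      exact mul_left_cancel₀ u1 (by linear_combination E2)
    have a01 : H1 = h := by
      rw [← e2, ← e3] at a23
      have := congrArg (A.T 6) a23
      rw [hT, hT] at this
      exact e1.symm.trans (this.symm.trans t0)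
    have a00 : h * H1 = 1 := by
      rw [← t0, ← e1, ← map_one (A.T 7), ← a12, ← e1, ← e2, map_mul, hT, hT]
      rfl
    exact close a01 (a01 ▸ a00)
  -- For the supports {1, 5} and {3, 7} the coefficient at 0 is a multiple of the one at 4.
  have c15 : u 3 = 0 → u 7 = 0 → u 1 * (H1 / h) - u 3 * (H3 / h) + u 5 + u 7 = 0 := by
    intro u3 u7
    simp only [u3, u7, zero_mul, add_zero, sub_zero] at E4 ⊢
    field_simp at E4 ⊢
    linear_combination E4
  have c17 : u 3 = 0 → u 5 = 0 → u 1 * (H1 / h) - u 3 * (H3 / h) + u 5 + u 7 = 0 := by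
    intro u3 u5
    simp only [u3, u5, zero_mul, add_zero] at E2 E4 E6
    have u7 : u 7 = -u 1 := by linear_combination E2
    by_cases u1 : u 1 = 0
    · simp [u5, u7, u3, u1]
    rw [u7] at E4 E6
    have a03 : H3 = -h := by
      field_simp at E4
      exact mul_left_cancel₀ u1 (by linear_combination E4)
    have a13 : H1 * H3 = 1 := by
      field_simp at E6
      exact mul_left_cancel₀ (mul_ne_zero u1 n2) (by linear_combination E6)
    have hsq := sq_of_13 a13
    have a14 : A.T 4 h = -H1 := by
      rw [← e1, ← map_neg, show A.T 4 h = A.T 1 (A.T 3 h) from A.add_apply 1 3 h, e3, a03]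
    rw [e4] at a14
    have a1 : H1 = -h := by
      field_simp at a14
      exact mul_left_cancel₀ H0 (by linear_combination a14 + hsq)
    have a2 : (1 : F) = -1 := by
      rw [← hsq, ← a13, a1, a03]; ring
    exact close (by linear_combination a1 - h * a2) (by linear_combination hsq - a2)
  have c35 : u 1 = 0 → u 7 = 0 → u 1 * (H1 / h) - u 3 * (H3 / h) + u 5 + u 7 = 0 := by
    intro u1 u7
    simp only [u1, u7, zero_mul, add_zero, zero_add, sub_zero] at E2 E4 E6
    have u5 : u 5 = -u 3 := by linear_combination E6
    by_cases u3 : u 3 = 0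
    · simp [u5, u7, u3, u1]
    rw [u5] at E2 E4
    have a01 : H1 = h := by
      field_simp at E4
      exact mul_left_cancel₀ u3 (by linear_combination E4)
    have a13 : H1 * H3 = 1 := by
      field_simp at E2
      exact mul_left_cancel₀ u3 (by linear_combination E2)
    have a02 : H2 = H1 := by
      rw [← e2, show A.T 2 h = A.T 1 (A.T 1 h) from A.add_apply 1 1 h, e1, a01, e1, a01]
    exact close a01 (by rw [← shift13 a13, a02, a01])
  have c37 : u 1 = 0 → u 5 = 0 → u 1 * (H1 / h) - u 3 * (H3 / h) + u 5 + u 7 = 0 := by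
    intro u1 u5
    simp only [u1, u5, zero_mul, add_zero, zero_add, zero_sub] at E4 ⊢
    field_simp at E4 ⊢
    linear_combination -E4
  have c57 : u 1 = 0 → u 3 = 0 → u 1 * (H1 / h) - u 3 * (H3 / h) + u 5 + u 7 = 0 := by
    intro u1 u3
    simp only [u1, u3, zero_mul, zero_add] at E2 E4 E6
    have u7 : u 7 = -(u 5 * (1 / (H1 * H2))) := by linear_combination E2
    by_cases u5 : u 5 = 0
    · simp [u5, u7, u3, u1]
    rw [u7] at E4 E6
    have a23 : H2 * H3 = -1 := by
      field_simp at E4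
      exact mul_left_cancel₀ (mul_ne_zero u5 H0) (by linear_combination E4)
    have a13 : H1 * H3 = 1 := by
      field_simp at E6
      exact mul_left_cancel₀ u5 (by linear_combination E6)
    have hsq := sq_of_13 a13
    have a02 := shift13 a13
    have a01 : h * H1 = -1 := by
      rw [← t0, ← e1, ← map_one (A.T 6), ← map_neg, ← a23, ← e2, ← e3, map_mul, hT, hT]
      rfl
    have a1 : H1 = h := mul_left_cancel₀ H0 (a01.trans hsq.symm)
    have a2 : H2 = H1 := by
      rw [← e2, show A.T 2 h = A.T 1 (A.T 1 h) from A.add_apply 1 1 h, e1, a1, e1, a1]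
    exact close a1 (by rw [← a02, a2, a1])
  obtain ⟨k, hk, l, hl, hkl, uk, ul⟩ := hu
  simp only [Finset.mem_insert, Finset.mem_singleton] at hk hl
  rcases hk with rfl | rfl | rfl | rfl <;> rcases hl with rfl | rfl | rfl | rfl
  exacts [(hkl rfl).elim, c57 uk ul, c37 uk ul, c35 uk ul,
    c57 ul uk, (hkl rfl).elim, c17 uk ul, c15 uk ul,
    c37 ul uk, c17 ul uk, (hkl rfl).elim, c13 uk ul,
    c35 ul uk, c15 ul uk, c13 ul uk, (hkl rfl).elim]

theorem eval_affine (c d : F) (v : ZMod 8 → F) (x : F) :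
    A.eval (fun i => (if i = 0 then c else 0) + d * v i) x = c * x + d * A.eval v x := by
  simp only [eval_apply, add_mul, Finset.sum_add_distrib, ite_mul, zero_mul,
    Finset.sum_ite_eq', Finset.mem_univ, if_true, A.zero_apply, Finset.mul_sum, mul_assoc]

/-- An odd binomial composed with `α + β ψ` is of the form `γ + δ ψ` only if `γ = δ = 0`. -/
theorem eq_zero_of_eval_eq {h : F} (hh : h * A.T 4 h = -1) {b : ZMod 8 → F}
    (hb : IsOddBinomial b) {α β γ δ : F}
    (H : ∀ x, A.eval b (α * x + β * A.eval (A.psiCoeff h) x)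
      = γ * x + δ * A.eval (A.psiCoeff h) x) : γ = 0 ∧ δ = 0 := by
  have hc : A.comp b (fun i => (if i = 0 then α else 0) + β * A.psiCoeff h i)
      = fun i => (if i = 0 then γ else 0) + δ * A.psiCoeff h i := by
    refine A.eval_injective (DFunLike.ext _ _ fun x => ?_)
    rw [eval_comp, eval_affine, eval_affine, H]
  have h0 : h ≠ 0 := by rintro rfl; simp at hh
  -- Both `b` and `ψ` are odd, so `β ψ` contributes only to even coefficients and `α` only to odd
  -- ones.
  have hodd : ∀ k ∈ ({1, 3, 5, 7} : Finset (ZMod 8)),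
      b k * A.T k α = δ * A.psiCoeff h k ∧ A.psiCoeff h k ≠ 0 := by
    intro k hk
    have hpar : ∀ k ∈ ({1, 3, 5, 7} : Finset (ZMod 8)), k ≠ 0 ∧
        ∀ i, i ∉ ({0, 2, 4, 6} : Finset (ZMod 8)) →
          k - i ∈ ({0, 2, 4, 6} : Finset (ZMod 8)) := by decide
    constructor
    · have h1 := congrFun hc k
      rw [comp, Finset.sum_eq_single k _ (by simp)] at h1
      · simpa [(hpar k hk).1, A.psiCoeff_even h (show (0 : ZMod 8) ∈ _ by decide)] using h1
      · intro i _ hi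
        by_cases hie : i ∈ ({0, 2, 4, 6} : Finset (ZMod 8))
        · rw [hb.1 i hie, zero_mul]
        · rw [A.psiCoeff_even h ((hpar k hk).2 i hie), if_neg (sub_ne_zero.2 hi.symm)]
          simp
    · simp only [Finset.mem_insert, Finset.mem_singleton] at hk
      rcases hk with rfl | rfl | rfl | rfl
      · exact one_ne_zero
      · exact one_ne_zero
      · exact mul_ne_zero h0 ((map_ne_zero _).2 h0)
      · exact div_ne_zero h0 ((map_ne_zero _).2 h0)
  -- `b` has a zero at some odd index, whereas `ψ` has none.
  have hδ : δ = 0 := by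
    obtain ⟨-, k, hk, -, -, -, h1, -⟩ := hb
    have := hodd k hk
    rw [h1, zero_mul] at this
    exact (mul_eq_zero.1 this.1.symm).resolve_right this.2
  refine ⟨?_, hδ⟩
  have heven : ∀ m ∈ ({0, 2, 4, 6} : Finset (ZMod 8)),
      A.comp (fun i => b i * A.T i β) (A.psiCoeff h) m = if m = 0 then γ else 0 := by
    intro m hm
    have h1 := congrFun hc m
    rw [hδ, zero_mul, add_zero] at h1
    rw [← h1]
    refine Finset.sum_congr rfl fun i _ => ?_
    by_cases hi : m = i
    · subst hi; simp [hb.1 m hm]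
    · simp only [if_neg (sub_ne_zero.2 hi), zero_add, map_mul, mul_assoc]
  have := A.comp_psiCoeff_zero_eq_zero hh (u := fun i => b i * A.T i β) (by
      obtain ⟨-, k, hk, l, hl, hkl, h1, h2⟩ := hb
      exact ⟨k, hk, l, hl, hkl, by simp [h1], by simp [h2]⟩)
    (fun i hi => by simp [hb.1 i hi]) (heven 2 (by decide)) (heven 4 (by decide))
    (heven 6 (by decide))
  exact (heven 0 (by decide)).symm.trans this

end FrobeniusFamily

/-! ### From a collineation to a linearized polynomial -/

namespace FrobeniusFamily

section Bridge

variable {F : Type*} [Field F] (A : FrobeniusFamily F)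

theorem semilinear_apply {σ : F ≃+* F} (φ : (F × F) →ₛₗ[(σ : F →+* F)] (F × F)) (x y : F) :
    φ (x, y) = ((φ (1, 0)).1 * σ x + (φ (0, 1)).1 * σ y,
      (φ (1, 0)).2 * σ x + (φ (0, 1)).2 * σ y) := by
  have h1 : ((x, y) : F × F) = x • (1, 0) + y • (0, 1) := by simp
  rw [h1, map_add, map_smulₛₗ, map_smulₛₗ]
  ext <;> simp [mul_comm]

/-- A set equivalent to `L_g` is the linear set of a linearized polynomial, in suitable
coordinates, with the same proper principal permanents as `g`. -/
theorem exists_samePermSums [Fintype F] {h : F} (hh : h * A.T 4 h = -1)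
    (hcomm : ∀ (σ : F ≃+* F) i x, σ (A.T i x) = A.T i (σ x)) {f g : F → F} {v : ZMod 8 → F}
    (hf : ∀ x, f x = A.eval (A.psiCoeff h) x) (hg : ∀ x, g x = A.eval v x)
    (H : PGammaLEquivalent (linearSet f) (linearSet g)) :
    ∃ b, A.SamePermSums b v ∧ ¬ IsOddBinomial b := by
  classical
  obtain ⟨σ, φ, hφ, himg⟩ := H
  -- The automorphism only replaces `h` by `σ h`, which satisfies the same norm condition.
  have hψ : ∀ x, σ (A.eval (A.psiCoeff h) x) = A.eval (A.psiCoeff (σ h)) (σ x) := by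
    intro x
    rw [eval_apply, eval_apply, map_sum]
    refine Finset.sum_congr rfl fun i _ => ?_
    rw [map_mul, hcomm]
    congr 1
    unfold psiCoeff
    split_ifs <;> simp [hcomm]
  have hh' : σ h * A.T 4 (σ h) = -1 := by rw [← hcomm, ← map_mul, hh, map_neg, map_one]
  have hφx := semilinear_apply φ
  set α := (φ (1, 0)).1
  set β := (φ (0, 1)).1
  set γ := (φ (1, 0)).2
  set δ := (φ (0, 1)).2
  set a : ZMod 8 → F := fun i => (if i = 0 then α else 0) + β * A.psiCoeff (σ h) i with ha
  set d : ZMod 8 → F := fun i => (if i = 0 then γ else 0) + δ * A.psiCoeff (σ h) i with hd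
  have hφa : ∀ x, φ (x, f x) = (A.eval a (σ x), A.eval d (σ x)) := by
    intro x
    rw [hφx, hf, hψ, ha, hd, eval_affine, eval_affine]
  have h1 : ∀ x, x ≠ 0 → ∃ y, y ≠ 0 ∧ ∃ μ, μ ≠ 0 ∧ A.eval a x = μ * y ∧
      A.eval d x = μ * A.eval v y := by
    intro x hx
    have hx' : σ.symm x ≠ 0 := by simpa using hx
    have hmem : Projectivization.map φ hφ.injective
        (Projectivization.mk F (σ.symm x, f (σ.symm x)) (fun h0 => hx' (congrArg Prod.fst h0)))
        ∈ linearSet g := himg ▸ Set.mem_image_of_mem _ ⟨σ.symm x, hx', rfl⟩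
    obtain ⟨y, hy, hxy⟩ := hmem
    rw [Projectivization.map_mk, Projectivization.mk_eq_mk_iff] at hxy
    obtain ⟨μ, hμ⟩ := hxy
    rw [hφa, RingEquiv.apply_symm_apply] at hμ
    exact ⟨y, hy, μ, μ.ne_zero, (congrArg Prod.fst hμ).symm,
      by rw [← hg]; exact (congrArg Prod.snd hμ).symm⟩
  have h2 : ∀ y, y ≠ 0 → ∃ x, x ≠ 0 ∧ ∃ μ, μ ≠ 0 ∧ A.eval a x = μ * y ∧
      A.eval d x = μ * A.eval v y := by
    intro y hy
    have hmem : Projectivization.mk F (y, g y) (fun h0 => hy (congrArg Prod.fst h0))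
        ∈ Projectivization.map φ hφ.injective '' linearSet f := himg ▸ ⟨y, hy, rfl⟩
    obtain ⟨P, ⟨x, hx, rfl⟩, hxy⟩ := hmem
    rw [Projectivization.map_mk, Projectivization.mk_eq_mk_iff] at hxy
    obtain ⟨μ, hμ⟩ := hxy
    rw [hφa] at hμ
    exact ⟨σ x, by simpa using hx, μ, μ.ne_zero, (congrArg Prod.fst hμ).symm,
      by rw [← hg]; exact (congrArg Prod.snd hμ).symm⟩
  -- No point of `linearSet g` has first coordinate 0, so `α + β ψ` is invertible and `b` is `γ + δ
  -- ψ` composed with its inverse.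
  have ha0 : ∀ x, A.eval a x = 0 → x = 0 := by
    intro x hx
    by_contra hne
    obtain ⟨y, hy, μ, hμ, hxy, -⟩ := h1 x hne
    exact mul_ne_zero hμ hy (hxy ▸ hx)
  obtain ⟨c, hc⟩ := A.exists_eval_inverse a ha0
  have hb : ∀ x, A.eval (A.comp d c) (A.eval a x) = A.eval d x := fun x => by
    rw [eval_comp, hc]
  have hsurj : Function.Surjective (A.eval a) :=
    Finite.surjective_of_injective ((injective_iff_map_eq_zero _).2 ha0)
  refine ⟨A.comp d c, fun n hn e he => A.permSum_eq (fun m => ⟨?_, ?_⟩) hn e he, fun hodd => ?_⟩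
  · rintro ⟨x, hx, hxm⟩
    obtain ⟨z, rfl⟩ := hsurj x
    obtain ⟨y, hy, μ, hμ, hzy, hzy'⟩ := h1 z (by rintro rfl; simp at hx)
    rw [hb, hzy, hzy'] at hxm
    exact ⟨y, hy, mul_left_cancel₀ hμ (by linear_combination hxm)⟩
  · rintro ⟨y, hy, hym⟩
    obtain ⟨x, hx, μ, hμ, hxy, hxy'⟩ := h2 y hy
    refine ⟨A.eval a x, fun h0 => hx (ha0 x h0), ?_⟩
    rw [hb, hxy, hxy', hym]
    ring
  · obtain ⟨hγ, hδ⟩ := A.eq_zero_of_eval_eq hh' hodd (α := α) (β := β) (γ := γ) (δ := δ)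
      fun x => by rw [← eval_affine, ← eval_affine, ← hb]
    obtain ⟨⟨x, y⟩, hxy⟩ := hφ.surjective (0, 1)
    rw [hφx, hγ, hδ] at hxy
    simpa using congrArg Prod.snd hxy

theorem eval_single (k : ZMod 8) (c x : F) : A.eval (Pi.single k c) x = c * A.T k x := by
  rw [eval_apply, Finset.sum_eq_single k (fun i _ hi => by simp [hi]) (by simp)]
  simp

theorem eval_add (b c : ZMod 8 → F) (x : F) : A.eval (b + c) x = A.eval b x + A.eval c x := by
  simp [eval_apply, add_mul, Finset.sum_add_distrib]

end Bridge

end FrobeniusFamily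

/-! ### Integer exponents and the main theorem -/

theorem intCast_mem_odd {r : ℤ} {n : ℕ} (hn : 2 ∣ n) (hr : Int.gcd r n = 1) :
    (r : ZMod 8) ∈ ({1, 3, 5, 7} : Finset (ZMod 8)) := by
  have hodd : Odd r := by
    rw [← Int.not_even_iff_odd]
    intro he
    have h2 : ((2 : ℕ) : ℤ) ∣ (Int.gcd r n : ℤ) :=
      Int.dvd_coe_gcd he.two_dvd (Int.natCast_dvd_natCast.2 hn)
    rw [hr] at h2
    norm_num at h2
  obtain ⟨k, rfl⟩ := hodd
  have h : ∀ k : ZMod 8, 2 * k + 1 ∈ ({1, 3, 5, 7} : Finset (ZMod 8)) := by decide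
  push_cast
  exact h k

theorem frob_eq_pow_val {F : Type*} [Field F] (q : ℕ) (m : ℤ) (x : F) :
    frob q 8 m x = x ^ q ^ (m : ZMod 8).val := by
  rw [frob, ← ZMod.val_intCast, Int.toNat_natCast]

/-- Odd classes modulo 8 are their own inverses, so the exponent `m` has index `s * m` with respect
to the powers of `x ↦ x ^ q ^ s`. -/
theorem exists_frobeniusFamily_frob {F : Type*} [Field F] [Fintype F] {q : ℕ} (hq : IsPrimePow q)
    (hF : Fintype.card F = q ^ 8) {s : ℤ} (hs : Int.gcd s 8 = 1) :
    ∃ A : FrobeniusFamily F, (∀ (σ : F ≃+* F) i x, σ (A.T i x) = A.T i (σ x)) ∧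
      (∀ (m : ℤ) (x : F), frob q 8 m x = A.T (s * m) x) ∧ ∀ x, A.T 4 x = x ^ q ^ 4 := by
  have hodd := intCast_mem_odd (n := 8) (by norm_num) hs
  have hss : (s : ZMod 8) * s = 1 ∧ ((s : ZMod 8) * 4).val = 4 := by
    revert hodd
    generalize (s : ZMod 8) = t
    revert t
    decide
  obtain ⟨A, hA⟩ := exists_frobeniusFamily hq hF (s : ZMod 8) hss.1
  refine ⟨A, fun σ i x => by rw [hA, hA, map_pow], fun m x => ?_, fun x => by rw [hA, hss.2]⟩
  rw [hA, ← mul_assoc, hss.1, one_mul, frob_eq_pow_val]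

theorem psi_eq_eval {F : Type*} [Field F] (A : FrobeniusFamily F) {q : ℕ} {s : ℤ}
    (hs : (s : ZMod 8) ∈ ({1, 3, 5, 7} : Finset (ZMod 8)))
    (hA : ∀ (m : ℤ) (x : F), frob q 8 m x = A.T (s * m) x) (h x : F) :
    psi q 4 h s x = A.eval (A.psiCoeff h) x := by
  have hss : ∀ t ∈ ({1, 3, 5, 7} : Finset (ZMod 8)), t * t = 1 ∧ t * (t * 3) = 3 ∧
      t * (t * 5) = 5 ∧ t * (t * 7) = 7 := by decide
  obtain ⟨h1, h3, h5, h7⟩ := hss _ hs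
  rw [A.eval_apply, FrobeniusFamily.sum_zmod_eight, A.psiCoeff_even h (i := 0) (by decide),
    A.psiCoeff_even h (i := 2) (by decide), A.psiCoeff_even h (i := 4) (by decide),
    A.psiCoeff_even h (i := 6) (by decide)]
  change frob q 8 s x + frob q 8 (s * ((4 : ℕ) - 1)) x
    + (h * frob q 8 s h) * frob q 8 (s * ((4 : ℕ) + 1)) x
    + (h / frob q 8 (s * (2 * (4 : ℕ) - 1)) h) * frob q 8 (s * (2 * (4 : ℕ) - 1)) x
    = 0 * _ + 1 * _ + 0 * _ + 1 * _ + 0 * _ + (h * A.T 1 h) * _ + 0 * _ + (h / A.T 7 h) * _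
  simp only [hA]
  push_cast
  rw [h1, h3, h5, h7]
  ring

end LinearSets

theorem mainTheorem7 {F : Type*} [Field F] [Fintype F] (q : ℕ) (hq : IsPrimePow q)
    (hF : Fintype.card F = q ^ 8) (h : F) (hh : h ^ (q ^ 4 + 1) = -1)
    (s : ℤ) (hs : Int.gcd s 8 = 1) :
    (∀ r : ℤ, Int.gcd r 8 = 1 →
      ¬ LinearSets.PGammaLEquivalent (LinearSets.linearSet (LinearSets.psi q 4 h s))
        (LinearSets.linearSet (LinearSets.gabidulinPoly q 8 r))) ∧
    (∀ (r : ℤ) (η : F), Int.gcd r 8 = 1 →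
      η ^ ((q ^ 8 - 1) / (q - 1)) ≠ 0 → η ^ ((q ^ 8 - 1) / (q - 1)) ≠ 1 →
      ¬ LinearSets.PGammaLEquivalent (LinearSets.linearSet (LinearSets.psi q 4 h s))
        (LinearSets.linearSet (LinearSets.twistedPoly q 8 r η))) ∧
    (∀ (r : ℤ) (δ : F), Int.gcd r 4 = 1 →
      δ ^ (q ^ 4 + 1) ≠ 0 → δ ^ (q ^ 4 + 1) ≠ 1 →
      LinearSets.IsScattered q (LinearSets.binomialPoly q 4 r δ) →
      ¬ LinearSets.PGammaLEquivalent (LinearSets.linearSet (LinearSets.psi q 4 h s))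
        (LinearSets.linearSet (LinearSets.binomialPoly q 4 r δ))) := by
  obtain ⟨A, hcomm, hA, hA4⟩ := LinearSets.exists_frobeniusFamily_frob hq hF hs
  have hs' := LinearSets.intCast_mem_odd (n := 8) (by norm_num) hs
  have hh' : h * A.T 4 h = -1 := by rw [hA4, ← pow_succ', hh]
  have hψ := LinearSets.psi_eq_eval A hs' hA h
  have hmul : ∀ t ∈ ({1, 3, 5, 7} : Finset (ZMod 8)), ∀ r ∈ ({1, 3, 5, 7} : Finset (ZMod 8)),
      t * r ∈ ({1, 3, 5, 7} : Finset (ZMod 8)) ∧ t * (7 * r) = -(t * r) ∧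
        t * (r + 4) = t * r + 4 ∧ t * r ≠ -(t * r) := by decide
  refine ⟨fun r hr H => ?_, fun r η hr hη _ H => ?_, fun r δ hr _ _ _ H => ?_⟩
  · have hr' := LinearSets.intCast_mem_odd (n := 8) (by norm_num) hr
    obtain ⟨b, hb, hb'⟩ := A.exists_samePermSums hh' hcomm hψ
      (v := Pi.single ((s : ZMod 8) * r) 1)
      (fun x => by rw [A.eval_single, one_mul, ← hA]; rfl) H
    exact hb' (hb.isOddBinomial_of_add_four (hmul _ hs' _ hr').1 fun i hi _ => by simp [hi])
  · have hr' := LinearSets.intCast_mem_odd (n := 8) (by norm_num) hr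
    obtain ⟨hm, hneg, -, hne⟩ := hmul _ hs' _ hr'
    have hη0 : η ≠ 0 := by
      rintro rfl
      have hq2 : 2 ≤ q := hq.two_le
      refine hη (zero_pow (Nat.div_pos ?_ (by omega)).ne')
      exact Nat.sub_le_sub_right (Nat.le_self_pow (by norm_num) q) 1
    obtain ⟨b, hb, hb'⟩ := A.exists_samePermSums hh' hcomm hψ
      (v := Pi.single ((s : ZMod 8) * r) η + Pi.single (-((s : ZMod 8) * r)) 1)
      (fun x => by
        rw [A.eval_add, A.eval_single, A.eval_single, one_mul, ← hA, ← hneg]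
        have h7 := hA (((8 : ℕ) - 1) * r) x
        push_cast at h7
        rw [← h7]
        rfl) H
    exact hb' (hb.isOddBinomial_of_neg hm (fun i hi hi' => by simp [hi, hi'])
      (by simp [hne, hη0]) (by simp [hne.symm]))
  · have hr' := LinearSets.intCast_mem_odd (n := 4) (by norm_num) hr
    obtain ⟨hm, -, h4, -⟩ := hmul _ hs' _ hr'
    obtain ⟨b, hb, hb'⟩ := A.exists_samePermSums hh' hcomm hψ
      (v := Pi.single ((s : ZMod 8) * r) δ + Pi.single ((s : ZMod 8) * r + 4) 1)
      (fun x => by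
        rw [A.eval_add, A.eval_single, A.eval_single, one_mul, ← hA, ← h4]
        have h5 := hA (r + (4 : ℕ)) x
        push_cast at h5
        rw [← h5]
        rfl) H
    exact hb' (hb.isOddBinomial_of_add_four hm fun i hi hi' => by simp [hi, hi'])
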